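/- A \emph{$\mathsf V$-algebra} is a Boolean algebra $C$ with a binary operation $\boxright$ such that, for all $x,y,z\in C$: (1) $x\boxright x=1$; (2) $(x\boxright y)\wedge(y\boxright x)\le (x\boxright z)\leftrightarrow(y\boxright z)$; (3) $((x\vee y)\boxright x)\vee((x\vee y)\boxright y)\vee\big(((x\vee y)\boxright z)\leftrightarrow((x\boxright z)\wedge(y\boxright z))\big)=1$; (4) $x\boxright(y\wedge z)=(x\boxright y)\wedge(x\boxright z)$. Homomorphisms are the Boolean homomorphisms preserving $\boxright$. An \emph{LC-algebra} is a $\mathsf V$-algebra satisfying $x\wedge y\le x\boxright y\le x\to y$; a \emph{CA-algebra} is an LC-algebra satisfying $(x\boxright y)\vee(x\boxright\neg y)=1$. A \emph{topological $\alpha$-model} is a Stone space $S$ (compact, Hausdorff, totally disconnected) with a function $f:Cl(S)\times S\to\mathcal P(S)$, where $Cl(S)$ is the set of clopen subsets of $S$, such that for all $A,B\in Cl(S)$ and $x\in S$: ($\alpha1$) $f(A,x)\subseteq A$; ($\alpha2$) if $f(A,x)\subseteq B$ and $f(B,x)\subseteq A$ then $f(A,x)=f(B,x)$; ($\alpha3$)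 $f(A\cup B,x)\subseteq A$, or $f(A\cup B,x)\subseteq B$, or $f(A\cup B,x)=f(A,x)\cup f(B,x)$; ($\alpha4$) $\{x\in S: f(A,x)\subseteq B\}$ is clopen; ($\alpha5$) $f(A,x)$ is closed. An \emph{$\alpha$-morphism} $\varphi:(S,f)\to(S',f')$ is a continuous map such that, for all $A'\in Cl(S')$ and $x\in S$: $y\in f(\varphi^{-1}[A'],x)$ implies $\varphi(y)\in f'(A',\varphi(x))$; and for every $y'\in f'(A',\varphi(x))$ there is $y\in f(\varphi^{-1}[A'],x)$ with $\varphi(y)=y'$. A topological $\alpha$-model is an \emph{$\alpha_1$-model} if $f(A,x)=\{x\}$ whenever $x\in A\in Cl(S)$, and an \emph{$\alpha_2$-model} if moreover every $f(A,x)$ has at most one element. Let $\mathscr A$ be the contravariant functor sending a $\mathsf V$-algebra $C$ to the space $Ul(C)$ of its ultrafilters, with the topology generated by the sets $\mathfrak s(a)=\{X\in Ul(C):a\in X\}$ for $a\in C$, equipped with the selection function $f_C$ given by $Y\in f_C(\mathfrak s(a),X)\iff\{c\in C:a\boxright c\in X\}\subseteq Y$, and sending a homomorphism $h$ to the map $X\mapsto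 h^{-1}[X]$. Let $\mathscr C$ be the contravariant functor sending a topological $\alpha$-model $(S,f)$ to the Boolean algebra $Cl(S)$ with $A\boxdot B=\{x\in S:f(A,x)\subseteq B\}$, and sending an $\alpha$-morphism $\varphi$ to the map $A\mapsto\varphi^{-1}[A]$. \textbf{Theorem.} The functors $\mathscr A$ and $\mathscr C$ establish a dual equivalence between the category of $\mathsf V$-algebras with homomorphisms and the category of topological $\alpha$-models with $\alpha$-morphisms. Moreover, $\mathscr A$ and $\mathscr C$ restrict to a dual equivalence between the full subcategories of LC-algebras and of topological $\alpha_1$-models, and to a dual equivalence between the full subcategories of CA-algebras and of topological $\alpha_2$-models. -/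

import Mathlib

open CategoryTheory TopologicalSpace

universe u

namespace Lewis

/-! ### `V`-algebras -/

/-- A (Lewis variably strict conditional) `V`-algebra: a Boolean algebra with a binary
operation `cf x y` (the counterfactual conditional `x □→ y`) satisfying four equations. The term
`(s ⇨ t) ⊓ (t ⇨ s)` is the Boolean biconditional `s ↔ t`. -/
class VAlgebra (C : Type u) extends BooleanAlgebra C where
  cf : C → C → C
  cf_self : ∀ x, cf x x = ⊤
  cf_congr : ∀ x y z, cf x y ⊓ cf y x ≤ (cf x z ⇨ cf y z) ⊓ (cf y z ⇨ cf x z)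
  cf_sup : ∀ x y z, cf (x ⊔ y) x ⊔ cf (x ⊔ y) y ⊔
    ((cf (x ⊔ y) z ⇨ (cf x z ⊓ cf y z)) ⊓ ((cf x z ⊓ cf y z) ⇨ cf (x ⊔ y) z)) = ⊤
  cf_inf : ∀ x y z, cf x (y ⊓ z) = cf x y ⊓ cf x z

open VAlgebra (cf)

theorem cf_mono {C : Type u} [VAlgebra C] (x : C) {y z : C} (h : y ≤ z) : cf x y ≤ cf x z := by
  have := VAlgebra.cf_inf x y z
  rw [inf_eq_left.mpr h] at this
  exact inf_eq_left.mp this.symm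

theorem cf_top {C : Type u} [VAlgebra C] (x : C) : cf x (⊤ : C) = ⊤ :=
  top_le_iff.mp ((VAlgebra.cf_self x).symm.le.trans (cf_mono x le_top))

/-- Homomorphisms of `V`-algebras: homomorphisms of Boolean algebras that preserve `cf`.
(A bounded lattice homomorphism between Boolean algebras preserves complement and implication.) -/
@[ext]
structure VHom (C D : Type u) [VAlgebra C] [VAlgebra D] extends BoundedLatticeHom C D where
  map_cf' : ∀ x y, toFun (cf x y) = cf (toFun x) (toFun y)

instance {C D : Type u} [VAlgebra C] [VAlgebra D] : FunLike (VHom C D) C D where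
  coe h := h.toFun
  coe_injective _ _ hk := VHom.ext hk

instance {C D : Type u} [VAlgebra C] [VAlgebra D] : BoundedLatticeHomClass (VHom C D) C D where
  map_sup h := h.map_sup'
  map_inf h := h.map_inf'
  map_top h := h.map_top'
  map_bot h := h.map_bot'

theorem VHom.map_cf {C D : Type u} [VAlgebra C] [VAlgebra D] (h : VHom C D) (x y : C) :
    h (cf x y) = cf (h x) (h y) := h.map_cf' x y

/-- Bundled `V`-algebras. -/
structure VAlg where
  carrier : Type u
  [str : VAlgebra carrier]

attribute [instance] VAlg.str

instance : CoeSort VAlg.{u} (Type u) := ⟨VAlg.carrier⟩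

/-- The category of `V`-algebras and their homomorphisms. -/
instance : Category VAlg.{u} where
  Hom C D := VHom C D
  id C := { BoundedLatticeHom.id C with map_cf' := fun _ _ => rfl }
  comp {C D E} h k :=
    { k.toBoundedLatticeHom.comp h.toBoundedLatticeHom with
      map_cf' := fun x y => by
        change k (h (cf x y)) = cf (k (h x)) (k (h y))
        rw [h.map_cf, k.map_cf] }

/-- The `V`-algebras satisfying `x ⊓ y ≤ (x □→ y) ≤ (x → y)`. -/
def isLC : ObjectProperty VAlg.{u} := fun C =>
  ∀ x y : C, x ⊓ y ≤ cf x y ∧ cf x y ≤ x ⇨ y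

/-- The `LC`-algebras satisfying `(x □→ y) ⊔ (x □→ ¬ y) = ⊤`. -/
def isCA : ObjectProperty VAlg.{u} := fun C =>
  isLC C ∧ ∀ x y : C, cf x y ⊔ cf x yᶜ = ⊤

/-! ### Topological `α`-models -/

/-- A topological `α`-model: a Stone space (compact, Hausdorff, totally disconnected) with a
selection function `sel : Cl(S) × S → 𝒫(S)`. -/
structure TopAlpha where
  carrier : Type u
  [top : TopologicalSpace carrier]
  [compact : CompactSpace carrier]
  [t2 : T2Space carrier]
  [totallyDisconnected : TotallyDisconnectedSpace carrier]
  sel : Clopens carrier → carrier → Set carrier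
  sel_subset : ∀ A x, sel A x ⊆ A
  sel_congr : ∀ (A B : Clopens carrier) x, sel A x ⊆ B → sel B x ⊆ A → sel A x = sel B x
  sel_sup : ∀ A B x, sel (A ⊔ B) x ⊆ A ∨ sel (A ⊔ B) x ⊆ B ∨ sel (A ⊔ B) x = sel A x ∪ sel B x
  isClopen_sel : ∀ A B : Clopens carrier, IsClopen {x | sel A x ⊆ B}
  isClosed_sel : ∀ A x, IsClosed (sel A x)

attribute [instance] TopAlpha.top TopAlpha.compact TopAlpha.t2 TopAlpha.totallyDisconnected

instance : CoeSort TopAlpha.{u} (Type u) := ⟨TopAlpha.carrier⟩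

/-- The preimage of a clopen set under a continuous map. -/
def preim {S T : Type u} [TopologicalSpace S] [TopologicalSpace T] (φ : S → T)
    (hφ : Continuous φ) (A : Clopens T) : Clopens S :=
  ⟨φ ⁻¹' A, A.isClopen.preimage hφ⟩

/-- `α`-morphisms. -/
@[ext]
structure AlphaHom (S T : TopAlpha.{u}) where
  toFun : S → T
  continuous_toFun : Continuous toFun
  forth : ∀ (A : Clopens T) (x y : S),
    y ∈ S.sel (preim toFun continuous_toFun A) x → toFun y ∈ T.sel A (toFun x)
  back : ∀ (A : Clopens T) (x : S) (y' : T), y' ∈ T.sel A (toFun x) →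
    ∃ y : S, toFun y = y' ∧ y ∈ S.sel (preim toFun continuous_toFun A) x

/-- The category of topological `α`-models and `α`-morphisms. -/
instance : Category TopAlpha.{u} where
  Hom S T := AlphaHom S T
  id S :=
    { toFun := id
      continuous_toFun := continuous_id
      forth := fun _ _ _ h => h
      back := fun _ _ y' h => ⟨y', rfl, h⟩ }
  comp φ ψ :=
    { toFun := ψ.toFun ∘ φ.toFun
      continuous_toFun := ψ.continuous_toFun.comp φ.continuous_toFun
      forth := fun A x y h => ψ.forth A _ _ (φ.forth (preim _ ψ.continuous_toFun A) x y h)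
      back := fun A x y'' h => by
        obtain ⟨y', rfl, hy'⟩ := ψ.back A _ y'' h
        obtain ⟨y, rfl, hy⟩ := φ.back _ x y' hy'
        exact ⟨y, rfl, hy⟩ }

/-- Topological `α₁`-models: `f(A, x) = {x}` whenever `x ∈ A`. -/
def isAlphaOne : ObjectProperty TopAlpha.{u} := fun S =>
  ∀ (A : Clopens S) (x : S), x ∈ A → S.sel A x = {x}

/-- Topological `α₂`-models: `α₁`-models such that `f(A, x)` has at most one element. -/
def isAlphaTwo : ObjectProperty TopAlpha.{u} := fun S =>
  isAlphaOne S ∧ ∀ (A : Clopens S) (x : S), (S.sel A x).Subsingleton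

/-! ### The functor `𝒞`: the algebra of clopen sets -/

/-- The `V`-algebra of clopen sets of a topological `α`-model, `A ⊡ B = {x | f(A, x) ⊆ B}`. -/
instance clopenVAlgebra (S : TopAlpha.{u}) : VAlgebra (Clopens S) where
  cf A B := ⟨{x | S.sel A x ⊆ B}, S.isClopen_sel A B⟩
  cf_self A := by
    ext x
    simpa using S.sel_subset A x
  cf_congr A B D := by
    rintro x ⟨h1, h2⟩
    have h := S.sel_congr A B x h1 h2
    rw [← SetLike.mem_coe, Clopens.coe_inf, Clopens.coe_himp, Clopens.coe_himp]
    simp [himp_eq, h, em]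
  cf_sup A B D := by
    ext x
    simp only [Clopens.coe_sup, Clopens.coe_inf, Clopens.coe_himp, Clopens.coe_top,
      Clopens.coe_mk, Set.mem_univ, iff_true]
    rcases S.sel_sup A B x with h | h | h
    · exact Or.inl (Or.inl h)
    · exact Or.inl (Or.inr h)
    · right
      simp [himp_eq, h, em]
  cf_inf A B D := by
    ext x
    simp

theorem mem_cf_iff (S : TopAlpha.{u}) (A B : Clopens S) (x : S) :
    x ∈ cf A B ↔ S.sel A x ⊆ B := Iff.rfl

/-- An `α`-morphism `φ : S → T` acts on clopen sets by `A ↦ φ⁻¹[A]`. -/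
def preimHom {S T : TopAlpha.{u}} (φ : AlphaHom S T) : VHom (Clopens T) (Clopens S) where
  toFun := preim φ.toFun φ.continuous_toFun
  map_sup' _ _ := rfl
  map_inf' _ _ := rfl
  map_top' := rfl
  map_bot' := rfl
  map_cf' A B := by
    apply SetLike.ext
    intro x
    change T.sel A (φ.toFun x) ⊆ B ↔
      S.sel (preim φ.toFun φ.continuous_toFun A) x ⊆ φ.toFun ⁻¹' B
    constructor
    · exact fun h y hy => h (φ.forth A x y hy)
    · intro h y' hy'
      obtain ⟨y, rfl, hy⟩ := φ.back A x y' hy'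
      exact h hy

/-- The contravariant functor `𝒞` from topological `α`-models to `V`-algebras. -/
def clopenFunctor : TopAlpha.{u}ᵒᵖ ⥤ VAlg.{u} where
  obj S := ⟨Clopens S.unop⟩
  map φ := preimHom φ.unop
  map_id _ := rfl
  map_comp _ _ := rfl

/-! ### Ultrafilters of a Boolean algebra and the Stone space -/

/-- Ultrafilters of a Boolean algebra. -/
@[ext]
structure Ult (B : Type u) [BooleanAlgebra B] where
  carrier : Set B
  top_mem' : ⊤ ∈ carrier
  inf_mem' : ∀ a b, a ∈ carrier → b ∈ carrier → a ⊓ b ∈ carrier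
  mem_of_le' : ∀ a b, a ≤ b → a ∈ carrier → b ∈ carrier
  bot_notMem' : ⊥ ∉ carrier
  mem_or_compl_mem' : ∀ a, a ∈ carrier ∨ aᶜ ∈ carrier

namespace Ult

variable {B : Type u} [BooleanAlgebra B]

instance : SetLike (Ult B) B where
  coe X := X.carrier
  coe_injective _ _ h := Ult.ext h

theorem top_mem (X : Ult B) : ⊤ ∈ X := X.top_mem'

theorem bot_notMem (X : Ult B) : ⊥ ∉ X := X.bot_notMem'

theorem mem_of_le (X : Ult B) {a b : B} (h : a ≤ b) (ha : a ∈ X) : b ∈ X :=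
  X.mem_of_le' a b h ha

theorem inf_mem_iff (X : Ult B) {a b : B} : a ⊓ b ∈ X ↔ a ∈ X ∧ b ∈ X :=
  ⟨fun h => ⟨X.mem_of_le inf_le_left h, X.mem_of_le inf_le_right h⟩,
    fun h => X.inf_mem' a b h.1 h.2⟩

theorem compl_mem_iff (X : Ult B) {a : B} : aᶜ ∈ X ↔ a ∉ X := by
  constructor
  · intro h h'
    apply X.bot_notMem
    rw [← inf_compl_eq_bot (a := a)]
    exact X.inf_mem_iff.mpr ⟨h', h⟩
  · exact (X.mem_or_compl_mem' a).resolve_left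

theorem sup_mem_iff (X : Ult B) {a b : B} : a ⊔ b ∈ X ↔ a ∈ X ∨ b ∈ X := by
  rw [← not_iff_not, ← compl_mem_iff, compl_sup, inf_mem_iff, compl_mem_iff, compl_mem_iff, not_or]

theorem himp_mem_iff (X : Ult B) {a b : B} : a ⇨ b ∈ X ↔ (a ∈ X → b ∈ X) := by
  rw [himp_eq, sup_mem_iff, compl_mem_iff]
  tauto

/-- The Boolean ultrafilter theorem: a filter disjoint from an ideal extends to an ultrafilter
that is still disjoint from the ideal. -/
theorem exists_ult (F I : Set B) (hFtop : ⊤ ∈ F) (hFinf : ∀ a ∈ F, ∀ b ∈ F, a ⊓ b ∈ F)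
    (hFup : ∀ a b, a ≤ b → a ∈ F → b ∈ F) (hIbot : ⊥ ∈ I) (hIsup : ∀ a ∈ I, ∀ b ∈ I, a ⊔ b ∈ I)
    (hIdown : ∀ a b, a ≤ b → b ∈ I → a ∈ I) (hFI : ∀ a ∈ F, a ∉ I) :
    ∃ X : Ult B, (∀ a ∈ F, a ∈ X) ∧ ∀ a ∈ I, a ∉ X := by
  have hF : Order.IsPFilter F := .of_def ⟨⊤, hFtop⟩
    (fun a ha b hb => ⟨a ⊓ b, hFinf a ha b hb, inf_le_left, inf_le_right⟩) (hFup _ _)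
  have hI : Order.IsIdeal I := ⟨fun a b h ha => hIdown b a h ha, ⟨⊥, hIbot⟩,
    fun a ha b hb => ⟨a ⊔ b, hIsup a ha b hb, le_sup_left, le_sup_right⟩⟩
  obtain ⟨J, hJ, hIJ, hFJ⟩ := DistribLattice.prime_ideal_of_disjoint_filter_ideal
    (F := hF.toPFilter) (I := hI.toIdeal) (Set.disjoint_left.mpr hFI)
  have hFJ' : ∀ a ∈ F, a ∉ J := fun a ha => Set.disjoint_left.mp hFJ ha
  refine ⟨⟨{a | a ∉ J}, hFJ' _ hFtop, fun a b ha hb h => ?_, fun a b h ha hb => ha (J.lower h hb),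
    fun h => h J.bot_mem, fun a => ?_⟩, hFJ', fun a ha h => h (hIJ ha)⟩
  · exact (hJ.mem_or_mem h).elim ha hb
  · by_contra! h
    simp only [Set.mem_ofPred_eq, not_not] at h
    apply hFJ' _ hFtop
    rw [← sup_compl_eq_top (x := a)]
    exact Order.Ideal.sup_mem h.1 h.2

/-- The Stone topology, generated by the sets `{X | a ∈ X}`. -/
instance : TopologicalSpace (Ult B) :=
  .generateFrom (Set.range fun a : B => {X : Ult B | a ∈ X})

theorem isClopen_mem (a : B) : IsClopen {X : Ult B | a ∈ X} := by
  have h : ∀ b : B, IsOpen {X : Ult B | b ∈ X} := fun b => .basic _ ⟨b, rfl⟩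
  refine ⟨⟨?_⟩, h a⟩
  convert h aᶜ using 1
  ext X
  exact X.compl_mem_iff.symm

/-- The Stone map `a ↦ {X | a ∈ X}`. -/
def stone (a : B) : Clopens (Ult B) := ⟨{X | a ∈ X}, isClopen_mem a⟩

theorem mem_stone {a : B} {X : Ult B} : X ∈ stone a ↔ a ∈ X := Iff.rfl

theorem stone_sup (a b : B) : stone (a ⊔ b) = stone a ⊔ stone b :=
  SetLike.ext fun X => X.sup_mem_iff

theorem le_of_stone_le {a b : B} (h : stone a ≤ stone b) : a ≤ b := by
  by_contra hab
  obtain ⟨X, h1, h2⟩ := exists_ult {c | a ≤ c} {c | c ≤ b} le_top (fun _ h _ h' => le_inf h h')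
    (fun _ _ h h' => le_trans h' h) bot_le (fun _ h _ h' => sup_le h h')
    (fun _ _ h h' => le_trans h h') (fun c h h' => hab (le_trans h h'))
  exact h2 b le_rfl (h (h1 a le_rfl))

theorem stone_injective : Function.Injective (stone : B → Clopens (Ult B)) := fun _ _ h =>
  le_antisymm (le_of_stone_le h.le) (le_of_stone_le h.ge)

instance : CompactSpace (Ult B) := by
  classical
  refine compactSpace_generateFrom rfl ?_
  intro P hP hcov
  by_contra! hfin
  let I : Set B := {b | ∃ t : Finset B, (∀ a ∈ t, {X : Ult B | a ∈ X} ∈ P) ∧ b ≤ t.sup id}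
  have htop : ⊤ ∉ I := by
    rintro ⟨t, ht, htt⟩
    refine hfin ((fun a : B => {X : Ult B | a ∈ X}) '' t) ?_ (t.finite_toSet.image _) ?_
    · rintro _ ⟨a, ha, rfl⟩
      exact ht a ha
    · rw [Set.eq_univ_iff_forall]
      intro X
      have hX : t.sup id ∈ X := X.mem_of_le htt X.top_mem
      have key : ∀ s : Finset B, s.sup id ∈ X → ∃ a ∈ s, a ∈ X := by
        intro s
        induction s using Finset.induction_on with
        | empty => exact fun h => (X.bot_notMem h).elim
        | insert a s _ ih =>
          rw [Finset.sup_insert, sup_mem_iff]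
          rintro (h | h)
          · exact ⟨a, by simp, h⟩
          · obtain ⟨b, hb, hbX⟩ := ih h
            exact ⟨b, by simp [hb], hbX⟩
      obtain ⟨a, ha, haX⟩ := key t hX
      exact ⟨_, ⟨a, ha, rfl⟩, haX⟩
  obtain ⟨X, -, hX⟩ := exists_ult {(⊤ : B)} I rfl (by simp) (fun a b h h' => by
      rw [Set.mem_singleton_iff] at h' ⊢
      exact top_le_iff.mp (h' ▸ h))
    ⟨∅, by simp, bot_le⟩
    (fun a ⟨s, hs, has⟩ b ⟨t, ht, hbt⟩ => ⟨s ∪ t, fun c hc => (Finset.mem_union.mp hc).elim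
      (hs c) (ht c), by rw [Finset.sup_union]; exact sup_le_sup has hbt⟩)
    (fun a b h ⟨s, hs, hbs⟩ => ⟨s, hs, h.trans hbs⟩) (fun a h => by
      rw [Set.mem_singleton_iff] at h
      exact h ▸ htop)
  have hXu : X ∈ ⋃₀ P := hcov ▸ Set.mem_univ X
  obtain ⟨U, hU, hXU⟩ := hXu
  obtain ⟨a, rfl⟩ := hP hU
  exact hX a ⟨{a}, by simpa using hU, by simp⟩ hXU

instance : TotallySeparatedSpace (Ult B) := by
  rw [totallySeparatedSpace_iff_exists_isClopen]
  intro X Y hXY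
  by_contra! h
  apply hXY
  have hle : ∀ a ∈ X, a ∈ Y := by
    intro a ha
    by_contra haY
    exact h _ (isClopen_mem a) ha haY
  refine SetLike.ext fun a => ⟨hle a, fun ha => ?_⟩
  by_contra haX
  exact Y.compl_mem_iff.mp (hle _ (X.compl_mem_iff.mpr haX)) ha

/-- Every clopen set of the Stone space is of the form `{X | a ∈ X}`. -/
theorem stone_surjective : Function.Surjective (stone : B → Clopens (Ult B)) := by
  classical
  intro A
  have hbasis : IsTopologicalBasis (Set.range fun a : B => {X : Ult B | a ∈ X}) := by
    refine ⟨?_, ?_, rfl⟩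
    · rintro _ ⟨a, rfl⟩ _ ⟨b, rfl⟩ X hX
      exact ⟨_, ⟨a ⊓ b, rfl⟩, X.inf_mem_iff.mpr hX, fun Y hY => Y.inf_mem_iff.mp hY⟩
    · rw [Set.eq_univ_iff_forall]
      exact fun X => ⟨_, ⟨⊤, rfl⟩, X.top_mem⟩
  obtain ⟨s, hs, hA⟩ := eq_finite_iUnion_of_isTopologicalBasis_of_isCompact_open _ hbasis
    (A : Set (Ult B)) A.isClosed.isCompact A.isOpen
  have key : ∀ t : Finset B, ∀ X : Ult B, t.sup id ∈ X ↔ ∃ a ∈ t, a ∈ X := by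
    intro t X
    induction t using Finset.induction_on with
    | empty => simpa using X.bot_notMem
    | insert a t _ ih => rw [Finset.sup_insert, sup_mem_iff, ih]; simp
  refine ⟨hs.toFinset.sup id, SetLike.ext fun X => ?_⟩
  rw [mem_stone, key, ← SetLike.mem_coe (p := A), hA]
  simp

end Ult

open Ult (stone)

/-! ### The functor `𝒜`: the ultrafilter space with its selection function -/

/-- The selection function of the ultrafilter space of a `V`-algebra: for every `a`,
`Y ∈ f(stone a, X)` iff `{c | (a □→ c) ∈ X} ⊆ Y`, see `mem_ultSel_stone`. Every clopen set `A`
is `stone a` for exactly one `a`. -/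
def ultSel {C : Type u} [VAlgebra C] (A : Clopens (Ult C)) (X : Ult C) : Set (Ult C) :=
  {Y | ∀ a : C, stone a = A → {c | cf a c ∈ X} ⊆ (Y : Set C)}

section

variable {C : Type u} [VAlgebra C]

theorem mem_ultSel_stone {a : C} {X Y : Ult C} :
    Y ∈ ultSel (stone a) X ↔ {c | cf a c ∈ X} ⊆ (Y : Set C) :=
  ⟨fun h => h a rfl, fun h b hb => by rwa [Ult.stone_injective hb]⟩

theorem ultSel_subset_stone {a b : C} {X : Ult C} :
    ultSel (stone a) X ⊆ stone b ↔ cf a b ∈ X := by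
  constructor
  · intro h
    by_contra hab
    obtain ⟨Y, h1, h2⟩ := Ult.exists_ult {c | cf a c ∈ X} {c | c ≤ b}
      (by simpa [cf_top] using X.top_mem)
      (fun c hc d hd => by
        rw [Set.mem_ofPred_eq, VAlgebra.cf_inf]
        exact X.inf_mem_iff.mpr ⟨hc, hd⟩)
      (fun c d h hc => X.mem_of_le (cf_mono a h) hc) bot_le (fun _ h _ h' => sup_le h h')
      (fun _ _ h h' => le_trans h h') (fun c hc h' => hab (X.mem_of_le (cf_mono a h') hc))
    exact h2 b le_rfl (h (mem_ultSel_stone.mpr h1))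
  · exact fun h Y hY => mem_ultSel_stone.mp hY h

end

/-- The topological `α`-model on the ultrafilter space of a `V`-algebra. -/
def ultModel (C : Type u) [VAlgebra C] : TopAlpha.{u} where
  carrier := Ult C
  sel := ultSel
  sel_subset A X := by
    obtain ⟨a, rfl⟩ := Ult.stone_surjective A
    rw [ultSel_subset_stone, VAlgebra.cf_self]
    exact X.top_mem
  sel_congr A B X hA hB := by
    obtain ⟨a, rfl⟩ := Ult.stone_surjective A
    obtain ⟨b, rfl⟩ := Ult.stone_surjective B
    rw [ultSel_subset_stone] at hA hB
    have h : ∀ c, cf a c ∈ X ↔ cf b c ∈ X := by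
      intro c
      have := X.mem_of_le (VAlgebra.cf_congr a b c) (X.inf_mem_iff.mpr ⟨hA, hB⟩)
      rw [X.inf_mem_iff, X.himp_mem_iff, X.himp_mem_iff] at this
      exact ⟨this.1, this.2⟩
    ext Y
    simp only [mem_ultSel_stone, h]
  sel_sup A B X := by
    obtain ⟨a, rfl⟩ := Ult.stone_surjective A
    obtain ⟨b, rfl⟩ := Ult.stone_surjective B
    rw [← Ult.stone_sup, ultSel_subset_stone, ultSel_subset_stone]
    by_cases ha : cf (a ⊔ b) a ∈ X
    · exact Or.inl ha
    by_cases hb : cf (a ⊔ b) b ∈ X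
    · exact Or.inr (Or.inl hb)
    refine Or.inr (Or.inr ?_)
    have h : ∀ c, cf (a ⊔ b) c ∈ X ↔ cf a c ∈ X ∧ cf b c ∈ X := by
      intro c
      have := VAlgebra.cf_sup a b c ▸ X.top_mem
      rw [X.sup_mem_iff, X.sup_mem_iff, X.inf_mem_iff, X.himp_mem_iff, X.himp_mem_iff,
        X.inf_mem_iff] at this
      have := this.resolve_left (not_or.mpr ⟨ha, hb⟩)
      exact ⟨this.1, this.2⟩
    ext Y
    rw [Set.mem_union, mem_ultSel_stone, mem_ultSel_stone, mem_ultSel_stone]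
    constructor
    · intro hY
      by_contra! hcon
      obtain ⟨⟨c, hc, hcY⟩, ⟨d, hd, hdY⟩⟩ := And.imp Set.not_subset.mp Set.not_subset.mp hcon
      have : c ⊔ d ∈ Y := hY ((h _).mpr
        ⟨X.mem_of_le (cf_mono a le_sup_left) hc, X.mem_of_le (cf_mono b le_sup_right) hd⟩)
      exact (Y.sup_mem_iff.mp this).elim hcY hdY
    · rintro (hY | hY) c hc
      · exact hY ((h c).mp hc).1
      · exact hY ((h c).mp hc).2
  isClopen_sel A B := by
    obtain ⟨a, rfl⟩ := Ult.stone_surjective A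
    obtain ⟨b, rfl⟩ := Ult.stone_surjective B
    simp only [ultSel_subset_stone]
    exact Ult.isClopen_mem _
  isClosed_sel A X := by
    obtain ⟨a, rfl⟩ := Ult.stone_surjective A
    have : ultSel (stone a) X = ⋂ c ∈ {c | cf a c ∈ X}, {Y : Ult C | c ∈ Y} := by
      ext Y
      rw [mem_ultSel_stone, Set.mem_iInter₂]
      rfl
    rw [this]
    exact isClosed_biInter fun c _ => (Ult.isClopen_mem c).isClosed

/-- The inverse image of an ultrafilter under a homomorphism. -/
def ultComap {C D : Type u} [VAlgebra C] [VAlgebra D] (h : VHom C D) (X : Ult D) : Ult C where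
  carrier := h ⁻¹' X
  top_mem' := by simpa using X.top_mem
  inf_mem' a b ha hb := by simpa [X.inf_mem_iff] using And.intro ha hb
  mem_of_le' a b hab := X.mem_of_le (OrderHomClass.mono h hab)
  bot_notMem' := by simpa using X.bot_notMem
  mem_or_compl_mem' a := by simpa [X.compl_mem_iff] using em (h a ∈ X)

theorem mem_ultComap {C D : Type u} [VAlgebra C] [VAlgebra D] {h : VHom C D} {X : Ult D} {a : C} :
    a ∈ ultComap h X ↔ h a ∈ X := Iff.rfl

theorem continuous_ultComap {C D : Type u} [VAlgebra C] [VAlgebra D] (h : VHom C D) :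
    Continuous (ultComap h) := by
  refine continuous_generateFrom_iff.mpr ?_
  rintro _ ⟨a, rfl⟩
  exact (Ult.isClopen_mem (h a)).isOpen

theorem ultComap_forth {C D : Type u} [VAlgebra C] [VAlgebra D] (h : VHom C D)
    (A : Clopens (Ult C)) (X Y : Ult D)
    (hY : Y ∈ ultSel (preim (ultComap h) (continuous_ultComap h) A) X) :
    ultComap h Y ∈ ultSel A (ultComap h X) := by
  obtain ⟨a, rfl⟩ := Ult.stone_surjective A
  have hY' : Y ∈ ultSel (stone (h a)) X := hY
  rw [mem_ultSel_stone] at hY'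
  refine mem_ultSel_stone.mpr fun c hc => hY' ?_
  rw [Set.mem_ofPred_eq, mem_ultComap, h.map_cf] at hc
  exact hc

theorem ultComap_back {C D : Type u} [VAlgebra C] [VAlgebra D] (h : VHom C D)
    (A : Clopens (Ult C)) (X : Ult D) (Y' : Ult C) (hY' : Y' ∈ ultSel A (ultComap h X)) :
    ∃ Y : Ult D, ultComap h Y = Y' ∧
      Y ∈ ultSel (preim (ultComap h) (continuous_ultComap h) A) X := by
  obtain ⟨a, rfl⟩ := Ult.stone_surjective A
  have hY : ∀ c, cf (h a) (h c) ∈ X → c ∈ Y' := by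
    intro c hc
    rw [← h.map_cf] at hc
    exact mem_ultSel_stone.mp hY' hc
  obtain ⟨Y, h1, h2⟩ := Ult.exists_ult {d | cf (h a) d ∈ X} {d | ∃ c, c ∉ Y' ∧ d ≤ h c}
    (by simpa [cf_top] using X.top_mem)
    (fun c hc d hd => by
      rw [Set.mem_ofPred_eq, VAlgebra.cf_inf]
      exact X.inf_mem_iff.mpr ⟨hc, hd⟩)
    (fun c d h hc => X.mem_of_le (cf_mono _ h) hc) ⟨⊥, Y'.bot_notMem, bot_le⟩
    (fun d ⟨c, hc, hd⟩ d' ⟨c', hc', hd'⟩ => ⟨c ⊔ c', fun hcc => (Y'.sup_mem_iff.mp hcc).elim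
      hc hc', by rw [map_sup]; exact sup_le_sup hd hd'⟩)
    (fun d d' hdd ⟨c, hc, hd⟩ => ⟨c, hc, hdd.trans hd⟩)
    (fun d hd ⟨c, hc, hdc⟩ => hc (hY c (X.mem_of_le (cf_mono _ hdc) hd)))
  refine ⟨Y, SetLike.ext fun c => ?_, (mem_ultSel_stone (a := h a)).mpr h1⟩
  constructor
  · intro hc
    by_contra hcY
    exact h2 (h c) ⟨c, hcY, le_rfl⟩ hc
  · intro hc
    by_contra hcY
    refine h2 (h cᶜ) ⟨cᶜ, fun hcc => Y'.compl_mem_iff.mp hcc hc, le_rfl⟩ ?_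
    rw [map_compl']
    exact Y.compl_mem_iff.mpr hcY

/-- A homomorphism `h : C → D` induces the `α`-morphism `X ↦ h⁻¹[X]`. -/
def ultHom {C D : Type u} [VAlgebra C] [VAlgebra D] (h : VHom C D) :
    AlphaHom (ultModel D) (ultModel C) where
  toFun := ultComap h
  continuous_toFun := continuous_ultComap h
  forth := ultComap_forth h
  back := ultComap_back h

/-- The contravariant functor `𝒜` from `V`-algebras to topological `α`-models. -/
def ultFunctor : VAlg.{u}ᵒᵖ ⥤ TopAlpha.{u} where
  obj C := ultModel C.unop
  map h := ultHom h.unop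
  map_id _ := rfl
  map_comp _ _ := rfl

end Lewis

namespace Lewis

open VAlgebra (cf)
open Ult (stone)

/-! ### The unit: the Stone map is an isomorphism of `V`-algebras -/

/-! This is Stone duality with an extra operation on each side. On algebras, `stone` is already a
Boolean isomorphism onto the clopen sets. It preserves the conditional by `ultSel_subset_stone`: the
ultrafilters selected for `a` at `X` are those extending the filter `{c | cf a c ∈ X}`, and a filter
is the intersection of the ultrafilters extending it.

On spaces, `pointUlt` is a homeomorphism by compactness and clopen separation. It carries `sel` to
`ultSel` because a closed set in a Stone space is the intersection of its clopen supersets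
(`pointUlt_mem_ultSel`). On both sides a bijective morphism is invertible, and naturality is
definitional.

For the restrictions, only objects need checking, since the subcategories are full: LC matches
`isAlphaOne` and CA matches `isAlphaTwo` under both functors. -/

/-- The inverse of a bijective homomorphism of `V`-algebras. -/
noncomputable def VHom.inverse {C D : Type u} [VAlgebra C] [VAlgebra D] (h : VHom C D)
    (hh : Function.Bijective h) : VHom D C :=
  let e := Equiv.ofBijective h hh
  have he : ∀ y, h (e.symm y) = y := e.apply_symm_apply
  { toFun := e.symm
    map_sup' := fun x y => hh.1 (by rw [map_sup h, he, he, he])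
    map_inf' := fun x y => hh.1 (by rw [map_inf h, he, he, he])
    map_top' := hh.1 (by rw [map_top h, he])
    map_bot' := hh.1 (by rw [map_bot h, he])
    map_cf' := fun x y => hh.1 (by
      rw [he, h.map_cf]
      exact congrArg₂ cf (he x).symm (he y).symm) }

/-- A bijective homomorphism of `V`-algebras is an isomorphism. -/
noncomputable def VAlg.isoOfBijective {C D : VAlg.{u}} (h : VHom C D)
    (hh : Function.Bijective h) : C ≅ D where
  hom := h
  inv := h.inverse hh
  hom_inv_id := VHom.ext (funext fun x => (Equiv.ofBijective h hh).symm_apply_apply x)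
  inv_hom_id := VHom.ext (funext fun x => (Equiv.ofBijective h hh).apply_symm_apply x)

/-- The Stone map as a homomorphism of `V`-algebras. -/
def stoneHom (C : Type u) [VAlgebra C] : VHom C (Clopens (ultModel C)) where
  toFun := (stone : C → Clopens (Ult C))
  map_sup' := Ult.stone_sup
  map_inf' _ _ := SetLike.ext fun X : Ult C => X.inf_mem_iff
  map_top' := SetLike.ext fun X : Ult C => iff_of_true X.top_mem trivial
  map_bot' := SetLike.ext fun X : Ult C => iff_of_false X.bot_notMem id
  -- This is the only clause that needs the Boolean ultrafilter theorem, through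
  -- `ultSel_subset_stone`.
  map_cf' _ _ := SetLike.ext fun _ : Ult C => ultSel_subset_stone.symm

theorem stoneHom_bijective (C : Type u) [VAlgebra C] : Function.Bijective (stoneHom C) :=
  ⟨Ult.stone_injective, Ult.stone_surjective⟩

/-- The Stone maps are natural. -/
noncomputable def unitIso :
    𝟭 VAlg.{u}ᵒᵖ ≅ ultFunctor ⋙ clopenFunctor.rightOp :=
  -- Passing to the opposite category reverses `stoneHom`, so the natural family runs towards the
  -- identity and is inverted at the end.
  (NatIso.ofComponents (F := ultFunctor ⋙ clopenFunctor.rightOp) (G := 𝟭 VAlg.{u}ᵒᵖ)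
    (fun C => (VAlg.isoOfBijective (D := ⟨Clopens (ultModel C.unop)⟩) (stoneHom C.unop)
      (stoneHom_bijective _)).op)
    (fun _ => rfl)).symm

/-! ### The counit: a topological `α`-model is the ultrafilter space of its clopen algebra -/

/-- The inverse of a bijective `α`-morphism. -/
noncomputable def AlphaHom.inverse {S T : TopAlpha.{u}} (φ : AlphaHom S T)
    (hφ : Function.Bijective φ.toFun) : AlphaHom T S :=
  -- A continuous bijection from a compact space to a Hausdorff space is a homeomorphism.
  let e := φ.continuous_toFun.homeoOfEquivCompactToT2 (f := Equiv.ofBijective φ.toFun hφ)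
  have hr : ∀ y, φ.toFun (e.symm y) = y := e.apply_symm_apply
  have hl : ∀ x, e.symm (φ.toFun x) = x := e.symm_apply_apply
  have hp : ∀ A : Clopens S, preim φ.toFun φ.continuous_toFun
      (preim e.symm e.symm.continuous A) = A := fun A => SetLike.ext fun x => by
    change e.symm (φ.toFun x) ∈ A ↔ x ∈ A
    rw [hl]
  { toFun := e.symm
    continuous_toFun := e.symm.continuous
    -- The two conditions swap roles: `forth` for the inverse is `back` for `φ`, and conversely. By
    -- `hp`, each clopen set of `S` is the preimage of one of `T`, so both apply.
    forth := fun A x y hy => by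
      rw [← hr x] at hy
      obtain ⟨z, rfl, hz⟩ := φ.back _ _ _ hy
      rw [hp] at hz
      rwa [hl]
    back := fun A x y hy => by
      refine ⟨φ.toFun y, hl y, ?_⟩
      rw [← hp A] at hy
      simpa only [hr] using φ.forth _ _ _ hy }

/-- A bijective `α`-morphism is an isomorphism. -/
noncomputable def TopAlpha.isoOfBijective {S T : TopAlpha.{u}} (φ : AlphaHom S T)
    (hφ : Function.Bijective φ.toFun) : S ≅ T where
  hom := φ
  inv := φ.inverse hφ
  hom_inv_id := AlphaHom.ext (funext fun x => (Equiv.ofBijective φ.toFun hφ).symm_apply_apply x)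
  inv_hom_id := AlphaHom.ext (funext fun x => (Equiv.ofBijective φ.toFun hφ).apply_symm_apply x)

section Point

variable {S : Type u} [TopologicalSpace S]

/-- The ultrafilter of the clopen sets that contain a given point. -/
def pointUlt (x : S) : Ult (Clopens S) where
  carrier := {A | x ∈ A}
  top_mem' := trivial
  inf_mem' _ _ ha hb := ⟨ha, hb⟩
  mem_of_le' _ _ h ha := h ha
  bot_notMem' := id
  mem_or_compl_mem' A := em (x ∈ A)

theorem mem_pointUlt {x : S} {A : Clopens S} : A ∈ pointUlt x ↔ x ∈ A := Iff.rfl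

theorem continuous_pointUlt : Continuous (pointUlt : S → Ult (Clopens S)) := by
  refine continuous_generateFrom_iff.mpr ?_
  rintro _ ⟨A, rfl⟩
  exact A.isOpen

variable [CompactSpace S]

/-- By compactness, the members of an ultrafilter, a directed family of nonempty closed sets, share
a point; maximality then makes the ultrafilter equal to that of the point. -/
theorem pointUlt_surjective : Function.Surjective (pointUlt : S → Ult (Clopens S)) := by
  intro U
  have : Nonempty U := ⟨⟨⊤, U.top_mem⟩⟩
  obtain ⟨x, hx⟩ : (⋂ A : U, ((A : Clopens S) : Set S)).Nonempty := by
    refine IsCompact.nonempty_iInter_of_directed_nonempty_isCompact_isClosed _ ?_ ?_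
      (fun A => A.1.isClosed.isCompact) fun A => A.1.isClosed
    · exact fun A B => ⟨⟨A.1 ⊓ B.1, U.inf_mem_iff.mpr ⟨A.2, B.2⟩⟩, fun _ h => h.1, fun _ h => h.2⟩
    · rintro ⟨A, hA⟩
      by_contra hne
      rw [Set.not_nonempty_iff_eq_empty] at hne
      exact U.bot_notMem ((Clopens.ext hne : A = ⊥) ▸ hA)
  have hU : ∀ A ∈ U, x ∈ A := fun A hA => Set.mem_iInter.mp hx ⟨A, hA⟩
  refine ⟨x, SetLike.ext fun A => ⟨fun h => ?_, hU A⟩⟩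
  by_contra hA
  exact hU Aᶜ (U.compl_mem_iff.mpr hA) h

variable [T2Space S] [TotallyDisconnectedSpace S]

/-- In a Stone space a closed set and a point outside it are separated by a clopen set. -/
theorem exists_clopens_of_notMem {F : Set S} (hF : IsClosed F) {y : S} (hy : y ∉ F) :
    ∃ B : Clopens S, F ⊆ B ∧ y ∉ B := by
  obtain ⟨V, hV, hyV, hVF⟩ := compact_exists_isClopen_in_isOpen hF.isOpen_compl hy
  exact ⟨⟨Vᶜ, hV.compl⟩, Set.subset_compl_comm.mp hVF, fun h => h hyV⟩

theorem pointUlt_injective : Function.Injective (pointUlt : S → Ult (Clopens S)) := by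
  intro x y hxy
  by_contra hne
  obtain ⟨B, hB, hy⟩ := exists_clopens_of_notMem (isClosed_singleton (x := x)) (Ne.symm hne)
  exact hy (mem_pointUlt.mp (hxy ▸ mem_pointUlt.mpr (hB rfl)))

end Point

/-- The closedness axiom (α5) is what makes this work: a point outside `S.sel A x` is excluded by
some clopen superset `B`, and such `B` are exactly those with `cf A B ∈ pointUlt x`. -/
theorem pointUlt_mem_ultSel {S : TopAlpha.{u}} {A : Clopens S} {x y : S} :
    pointUlt y ∈ ultSel (stone A) (pointUlt x) ↔ y ∈ S.sel A x := by
  rw [mem_ultSel_stone]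
  constructor
  · intro h
    by_contra hy
    obtain ⟨B, hB, hyB⟩ := exists_clopens_of_notMem (S.isClosed_sel A x) hy
    exact hyB (h hB)
  · exact fun hy B hB => hB hy

/-- The canonical `α`-morphism from a topological `α`-model to the ultrafilter space of its
algebra of clopen sets. -/
def pointHom (S : TopAlpha.{u}) : AlphaHom S (ultModel (Clopens S)) where
  toFun := pointUlt
  continuous_toFun := continuous_pointUlt
  forth A x y hy := by
    obtain ⟨A, rfl⟩ := Ult.stone_surjective A
    exact pointUlt_mem_ultSel.mpr hy
  back A x Y hY := by
    obtain ⟨A, rfl⟩ := Ult.stone_surjective A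
    obtain ⟨y, rfl⟩ := pointUlt_surjective Y
    exact ⟨y, rfl, pointUlt_mem_ultSel.mp hY⟩

theorem pointHom_bijective (S : TopAlpha.{u}) : Function.Bijective (pointHom S).toFun :=
  ⟨pointUlt_injective, pointUlt_surjective⟩

/-- The canonical maps of topological `α`-models to the ultrafilter spaces are natural. -/
noncomputable def counitIso :
    clopenFunctor.rightOp ⋙ ultFunctor ≅ 𝟭 TopAlpha.{u} :=
  (NatIso.ofComponents (F := 𝟭 TopAlpha.{u}) (G := clopenFunctor.rightOp ⋙ ultFunctor)
    (fun S : TopAlpha.{u} => TopAlpha.isoOfBijective (T := ultModel (Clopens S)) (pointHom S)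
      (pointHom_bijective S))
    (fun _ => rfl)).symm

/-- The dual equivalence between `V`-algebras and topological `α`-models. -/
noncomputable def dualEquivalence : VAlg.{u}ᵒᵖ ≌ TopAlpha.{u} :=
  -- No triangle identity has to be checked: `Equivalence.mk` adjusts the unit to satisfy it.
  .mk ultFunctor clopenFunctor.rightOp unitIso counitIso

/-! ### Restriction to subcategories -/

theorem exists_restrict_dualEquivalence (P : ObjectProperty VAlg.{u})
    (Q : ObjectProperty TopAlpha.{u}) (hPQ : ∀ C : VAlg.{u}, P C → Q (ultModel C))
    (hQP : ∀ S : TopAlpha.{u}, Q S → P ⟨Clopens S⟩) :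
    ∃ e : P.FullSubcategoryᵒᵖ ≌ Q.FullSubcategory,
      e.functor ⋙ Q.ι = P.ι.op ⋙ ultFunctor ∧
      e.inverse ⋙ P.ι.op = Q.ι ⋙ clopenFunctor.rightOp := by
  let F : P.FullSubcategoryᵒᵖ ⥤ Q.FullSubcategory :=
    Q.lift (P.ι.op ⋙ ultFunctor) fun C => hPQ _ C.unop.property
  let G : Q.FullSubcategory ⥤ P.FullSubcategoryᵒᵖ :=
    (P.lift (Q.ι.op ⋙ clopenFunctor) fun S => hQP _ S.unop.property).rightOp
  -- Whiskering with a fully faithful inclusion is fully faithful, so the ambient unit and counit,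
  -- restricted to the subcategories, lift uniquely.
  let η : 𝟭 P.FullSubcategoryᵒᵖ ≅ F ⋙ G :=
    (P.fullyFaithfulι.op.whiskeringRight _).preimageIso (Functor.isoWhiskerLeft P.ι.op unitIso)
  let ε : G ⋙ F ≅ 𝟭 Q.FullSubcategory :=
    (Q.fullyFaithfulι.whiskeringRight _).preimageIso (Functor.isoWhiskerLeft Q.ι counitIso)
  exact ⟨.mk F G η ε, rfl, rfl⟩

/-! ### LC against α₁, and CA against α₂ -/

theorem Ult.eq_of_subset {B : Type u} [BooleanAlgebra B] {X Y : Ult B} (h : ∀ a ∈ X, a ∈ Y) :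
    X = Y :=
  SetLike.ext fun a => ⟨h a, fun ha => by
    by_contra haX
    exact Y.compl_mem_iff.mp (h _ (X.compl_mem_iff.mpr haX)) ha⟩

/-- The two LC inequalities split the work: the upper bound on `cf a c` puts `X` in its own
selection set, and the lower bound forces every selected ultrafilter to contain `X`, hence to equal
it. -/
theorem isAlphaOne_ultModel (C : VAlg.{u}) (hC : isLC C) : isAlphaOne (ultModel C) := by
  intro A (X : Ult C) hX
  obtain ⟨a, rfl⟩ := Ult.stone_surjective A
  have ha : a ∈ X := hX
  refine Set.eq_singleton_iff_unique_mem.mpr ⟨mem_ultSel_stone.mpr fun c hc =>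
    X.himp_mem_iff.mp (X.mem_of_le (hC a c).2 hc) ha,
    fun Y hY => (Ult.eq_of_subset fun c hc => ?_).symm⟩
  exact mem_ultSel_stone.mp hY (X.mem_of_le (hC a c).1 (X.inf_mem_iff.mpr ⟨ha, hc⟩))

theorem isLC_clopens (S : TopAlpha.{u}) (hS : isAlphaOne S) : isLC ⟨Clopens S⟩ := by
  intro (A : Clopens S) (B : Clopens S)
  constructor
  · rintro x ⟨hA, hB⟩
    change S.sel A x ⊆ B
    rw [hS A x hA]
    exact Set.singleton_subset_iff.mpr hB
  · rw [le_himp_iff]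
    rintro x ⟨h, hA⟩
    have h : S.sel A x ⊆ B := h
    rw [hS A x hA] at h
    exact h rfl

/-- Conditional excluded middle makes `X` decide each `c`: `cf a c` or `cf a cᶜ` lies in `X`, so any
two selected ultrafilters agree on `c`. -/
theorem isAlphaTwo_ultModel (C : VAlg.{u}) (hC : isCA C) : isAlphaTwo (ultModel C) := by
  refine ⟨isAlphaOne_ultModel C hC.1, fun A (X : Ult C) Y hY Z hZ => Ult.eq_of_subset ?_⟩
  obtain ⟨a, rfl⟩ := Ult.stone_surjective A
  intro c hc
  rcases X.sup_mem_iff.mp (hC.2 a c ▸ X.top_mem) with h | h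
  · exact mem_ultSel_stone.mp hZ h
  · exact absurd hc (Y.compl_mem_iff.mp (mem_ultSel_stone.mp hY h))

theorem isCA_clopens (S : TopAlpha.{u}) (hS : isAlphaTwo S) : isCA ⟨Clopens S⟩ := by
  refine ⟨isLC_clopens S hS.1, fun (A : Clopens S) (B : Clopens S) => ?_⟩
  refine SetLike.ext fun x => iff_of_true ?_ trivial
  change S.sel A x ⊆ B ∨ S.sel A x ⊆ (B : Set S)ᶜ
  -- A set with at most one point lies inside `B` or inside its complement.
  rcases (hS.2 A x).eq_empty_or_singleton with h | ⟨y, h⟩ <;> rw [h]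
  · exact Or.inl (Set.empty_subset _)
  · simpa only [Set.singleton_subset_iff, Set.mem_compl_iff] using em (y ∈ (B : Set S))

end Lewis

theorem mainTheorem2 :
    (∃ e : Lewis.VAlg.{u}ᵒᵖ ≌ Lewis.TopAlpha.{u},
      e.functor = Lewis.ultFunctor ∧ e.inverse = Lewis.clopenFunctor.rightOp) ∧
    (∃ e : (Lewis.isLC.{u}.FullSubcategory)ᵒᵖ ≌ Lewis.isAlphaOne.{u}.FullSubcategory,
      e.functor ⋙ Lewis.isAlphaOne.ι = Lewis.isLC.ι.op ⋙ Lewis.ultFunctor ∧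
      e.inverse ⋙ Lewis.isLC.ι.op = Lewis.isAlphaOne.ι ⋙ Lewis.clopenFunctor.rightOp) ∧
    (∃ e : (Lewis.isCA.{u}.FullSubcategory)ᵒᵖ ≌ Lewis.isAlphaTwo.{u}.FullSubcategory,
      e.functor ⋙ Lewis.isAlphaTwo.ι = Lewis.isCA.ι.op ⋙ Lewis.ultFunctor ∧
      e.inverse ⋙ Lewis.isCA.ι.op = Lewis.isAlphaTwo.ι ⋙ Lewis.clopenFunctor.rightOp) :=
  ⟨⟨Lewis.dualEquivalence, rfl, rfl⟩,
    Lewis.exists_restrict_dualEquivalence _ _ Lewis.isAlphaOne_ultModel Lewis.isLC_clopens,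
    Lewis.exists_restrict_dualEquivalence _ _ Lewis.isAlphaTwo_ultModel Lewis.isCA_clopens⟩
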